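/- Let $n\ge 2$ and let $A$ be an invertible real $n\times n$ matrix with rows $A_1^T,\dots,A_n^T$. Put $$\mathcal R_i = I_n - 2\,\frac{A_iA_i^T}{\|A_i\|^2}\quad(1\le i\le n),\qquad \mathcal R_A=\mathcal R_n\cdots\mathcal R_2\mathcal R_1,$$ and let $\kappa=\|A\|\,\|A^{-1}\|$ be the condition number of $A$, where $\|\cdot\|$ is the Euclidean norm on vectors and the operator norm it induces on matrices. The $n$ complex eigenvalues of $\mathcal R_A$, counted with algebraic multiplicity, can be written as $e^{i\theta_1},\dots,e^{i\theta_n}$ with real $\theta_l$, $|\theta_l|\le\pi$. For every such choice of the $\theta_l$ we have $\min_l|\theta_l|>0$ and $$\frac{1}{\min_l|\theta_l|} = O\big((\log n)\,\kappa^2\big),$$ that is, there is an absolute constant $C$, independent of $n$ and $A$, such that $1/\min_l|\theta_l|\le C\,(\log n)\,\kappa^2$ for all $n\ge 2$ and all such $A$. -/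

import Mathlib

namespace Kaczmarz

/-- The reflection generated by the `i`-th row `A_i` (read as a column vector) of an `m × n` real
matrix: `I_n - 2 A_i A_iᵀ / ‖A_i‖²`, where `‖A_i‖² = A_i ⬝ᵥ A_i` is the squared Euclidean norm. -/
noncomputable def reflection {m n : ℕ} (A : Matrix (Fin m) (Fin n) ℝ) (i : Fin m) :
    Matrix (Fin n) (Fin n) ℝ :=
  1 - (2 / (A i ⬝ᵥ A i)) • Matrix.vecMulVec (A i) (A i)

/-- The product `R_m ⋯ R_2 R_1` of the reflections generated by the rows of `A`; the reflection
of the first row is the rightmost factor. -/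
noncomputable def reflectionProd {m n : ℕ} (A : Matrix (Fin m) (Fin n) ℝ) :
    Matrix (Fin n) (Fin n) ℝ :=
  (List.ofFn (fun i => reflection A i)).reverse.prod

/-- `θ_1, …, θ_n ∈ [-π, π]` are eigenphases of the real `n × n` matrix `M`: the numbers
`e^{i θ_l}` are the `n` complex eigenvalues of `M`, listed with algebraic multiplicity. -/
def IsEigenphases {n : ℕ} (M : Matrix (Fin n) (Fin n) ℝ) (θ : Fin n → ℝ) : Prop :=
  (∀ l, |θ l| ≤ Real.pi) ∧
    (M.map (algebraMap ℝ ℂ)).charpoly.roots =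
      Finset.univ.val.map (fun l : Fin n => Complex.exp ((θ l : ℂ) * Complex.I))

/-- The condition number `κ = ‖A‖ ‖A⁻¹‖` in the Euclidean operator norm (meant for
invertible `A`). -/
noncomputable def conditionNumber {n : ℕ} (A : Matrix (Fin n) (Fin n) ℝ) : ℝ :=
  ‖Matrix.toEuclideanCLM (n := Fin n) (𝕜 := ℝ) A‖ *
    ‖Matrix.toEuclideanCLM (n := Fin n) (𝕜 := ℝ) A⁻¹‖

end Kaczmarz

/-!
Let `x` be an eigenvector of `R_n ⋯ R_1` with eigenvalue `μ`, and follow it through the reflections: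
`x₀ = x` and `x_{k+1} = x_k - 2 u_k`, where `u_k = z_k A_k` is the orthogonal projection of `x_k` on
the `k`-th row. Each step preserves the norm, so `|μ| = 1`. Summing the steps,
`(1 - μ) x = 2 w` with `w = ∑ u_k = Aᵀ z`, and pairing `x_k = x - 2 ∑_{j<k} u_j` with `u_k` gives
`⟪w, x⟫ = ∑ ‖u_k‖² + 2 ∑_{j<k} ⟪u_k, u_j⟫`. Hence `2 ‖w‖² = |1 - μ| |⟪w, x⟫|`.

On the left, `‖w‖ ≥ ‖z‖ / ‖A⁻¹‖`. On the right, the diagonal is at most `‖A‖² ‖z‖²`, and the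
strictly triangular sum is bounded by halving the index interval (`norm_triangular_sum_le`): the
off-diagonal block is a single inner product, controlled by Cauchy–Schwarz, and the two diagonal
blocks are treated recursively. Each of the `⌈log₂ n⌉` levels costs `‖A‖² ‖z‖² / 2`. Therefore
`2 ≤ |1 - μ| (1 + ⌈log₂ n⌉) κ²`, and `|1 - exp (iθ)| ≤ |θ|` gives the result. Working with the
unnormalized rows is what makes the condition number of `A` itself appear, rather than that of the
row-normalized matrix.
-/

namespace Kaczmarz

open Finset

/-! ### Sequences of reflected vectors -/

section InnerProduct

variable {E : Type*} [NormedAddCommGroup E] [InnerProductSpace ℂ E]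

/-- The dyadic bound for the strictly triangular part of a Gram matrix: an interval of at most
`2 ^ m` indices is halved `m` times. -/
lemma norm_triangular_sum_le (u : ℕ → E) (c : ℕ → ℝ) (B : ℝ)
    (h : ∀ a b, ‖∑ k ∈ Ico a b, u k‖ ^ 2 ≤ B * ∑ k ∈ Ico a b, c k) (m : ℕ) :
    ∀ a b, a ≤ b → b - a ≤ 2 ^ m →
      ‖∑ k ∈ Ico a b, ∑ j ∈ Ico a k, inner ℂ (u k) (u j)‖ ≤
        m / 2 * (B * ∑ k ∈ Ico a b, c k) := by
  induction m with
  | zero =>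
    intro a b hab hb
    have hzero : ∑ k ∈ Ico a b, ∑ j ∈ Ico a k, inner ℂ (u k) (u j) = 0 := by
      refine sum_eq_zero fun k hk => ?_
      rw [mem_Ico] at hk
      have hka : k = a := by simp at hb; omega
      simp [hka]
    simp [hzero]
  | succ m ih =>
    intro a b hab hb
    obtain ⟨d, had, hdb, h1, h2⟩ : ∃ d, a ≤ d ∧ d ≤ b ∧ d - a ≤ 2 ^ m ∧ b - d ≤ 2 ^ m := by
      rw [pow_succ] at hb
      exact ⟨a + (b - a) / 2, by omega, by omega, by omega, by omega⟩
    have hsplit : ∑ k ∈ Ico a b, ∑ j ∈ Ico a k, inner ℂ (u k) (u j) =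
        ∑ k ∈ Ico a d, ∑ j ∈ Ico a k, inner ℂ (u k) (u j) +
          (∑ k ∈ Ico d b, ∑ j ∈ Ico d k, inner ℂ (u k) (u j) +
            inner ℂ (∑ k ∈ Ico d b, u k) (∑ j ∈ Ico a d, u j)) := by
      rw [← sum_Ico_consecutive _ had hdb, sum_inner, ← sum_add_distrib]
      congr 1
      refine sum_congr rfl fun k hk => ?_
      rw [inner_sum, ← sum_Ico_consecutive _ had (mem_Ico.1 hk).1, add_comm]
    have hcs := norm_inner_le_norm (𝕜 := ℂ) (∑ k ∈ Ico d b, u k) (∑ j ∈ Ico a d, u j)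
    have hc := sum_Ico_consecutive c had hdb
    have hleft := ih a d had h1
    have hright := ih d b hdb h2
    have hu1 := h a d
    have hu2 := h d b
    have hsq := sq_nonneg (‖∑ k ∈ Ico d b, u k‖ - ‖∑ j ∈ Ico a d, u j‖)
    rw [hsplit, ← hc]
    refine (norm_add_le_of_le le_rfl (norm_add_le _ _)).trans ?_
    push_cast
    nlinarith

variable {x u : ℕ → E}

lemma reflected_eq_sub_sum (hx : ∀ k, x (k + 1) = x k - (2 : ℂ) • u k) (k : ℕ) :
    x k = x 0 - (2 : ℂ) • ∑ j ∈ Ico 0 k, u j := by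
  induction k with
  | zero => simp
  | succ k ih => rw [hx, ih, sum_Ico_succ_top (Nat.zero_le k), smul_add]; abel

/-- If each `u k` is the orthogonal projection of `x k` on a line, encoded as
`⟪u k, x k⟫ = ‖u k‖ ^ 2`, then the steps `x k ↦ x k - 2 u k` are reflections. -/
lemma norm_reflected_eq (hx : ∀ k, x (k + 1) = x k - (2 : ℂ) • u k)
    (hu : ∀ k, inner ℂ (u k) (x k) = ((‖u k‖ ^ 2 : ℝ) : ℂ)) (k : ℕ) : ‖x k‖ = ‖x 0‖ := by
  induction k with
  | zero => rfl
  | succ k ih =>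
    rw [← ih, ← sq_eq_sq₀ (norm_nonneg _) (norm_nonneg _), hx, @norm_sub_sq ℂ, inner_smul_right,
      ← inner_conj_symm, hu, norm_smul]
    simp only [Complex.conj_ofReal, mul_pow]
    have h2 : RCLike.re ((2 : ℂ) * ((‖u k‖ ^ 2 : ℝ) : ℂ)) = 2 * ‖u k‖ ^ 2 := by
      rw [← Complex.ofReal_ofNat, ← Complex.ofReal_mul]; rfl
    rw [h2]
    norm_num
    ring

lemma inner_sum_reflected_zero (hx : ∀ k, x (k + 1) = x k - (2 : ℂ) • u k)
    (hu : ∀ k, inner ℂ (u k) (x k) = ((‖u k‖ ^ 2 : ℝ) : ℂ)) (n : ℕ) :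
    inner ℂ (∑ k ∈ Ico 0 n, u k) (x 0) =
      ((∑ k ∈ Ico 0 n, ‖u k‖ ^ 2 : ℝ) : ℂ) +
        2 * ∑ k ∈ Ico 0 n, ∑ j ∈ Ico 0 k, inner ℂ (u k) (u j) := by
  rw [sum_inner, Complex.ofReal_sum, mul_sum, ← sum_add_distrib]
  refine sum_congr rfl fun k _ => ?_
  rw [← hu k, reflected_eq_sub_sum hx k, inner_sub_right, inner_smul_right, inner_sum]
  ring

lemma two_mul_norm_sum_sq_le (hx : ∀ k, x (k + 1) = x k - (2 : ℂ) • u k)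
    (hu : ∀ k, inner ℂ (u k) (x k) = ((‖u k‖ ^ 2 : ℝ) : ℂ)) {n m : ℕ} (hn : n ≤ 2 ^ m) {μ : ℂ}
    (hμ : x n = μ • x 0) (c : ℕ → ℝ) (B : ℝ)
    (h : ∀ a b, ‖∑ k ∈ Ico a b, u k‖ ^ 2 ≤ B * ∑ k ∈ Ico a b, c k) :
    2 * ‖∑ k ∈ Ico 0 n, u k‖ ^ 2 ≤ ‖1 - μ‖ * ((1 + m) * (B * ∑ k ∈ Ico 0 n, c k)) := by
  set w := ∑ k ∈ Ico 0 n, u k with hw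
  have hwx : (1 - μ) • x 0 = (2 : ℂ) • w := by
    rw [sub_smul, one_smul, ← hμ, reflected_eq_sub_sum hx n, sub_sub_cancel]
  have hnorm : 2 * ‖w‖ ^ 2 = ‖1 - μ‖ * ‖inner ℂ w (x 0)‖ := by
    rw [← norm_mul, ← inner_smul_right, hwx, inner_smul_right, norm_mul,
      inner_self_eq_norm_sq_to_K]
    simp
  rw [hnorm]
  refine mul_le_mul_of_nonneg_left ?_ (norm_nonneg _)
  have hdiag : ∑ k ∈ Ico 0 n, ‖u k‖ ^ 2 ≤ B * ∑ k ∈ Ico 0 n, c k := by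
    rw [mul_sum]
    refine sum_le_sum fun k _ => ?_
    simpa using h k (k + 1)
  have htri := norm_triangular_sum_le u c B h m 0 n (Nat.zero_le _) (by simpa using hn)
  rw [hw, inner_sum_reflected_zero hx hu n]
  refine (norm_add_le _ _).trans ?_
  rw [norm_mul, Complex.norm_real, Real.norm_of_nonneg (sum_nonneg fun _ _ => by positivity),
    Complex.norm_two]
  linarith

end InnerProduct

/-! ### Complex vectors and the real operator norm -/

/-- The operator norm of a real matrix also bounds its transpose on complex vectors. -/
lemma sum_norm_sq_vecMul_le {n : ℕ} (A : Matrix (Fin n) (Fin n) ℝ) (z : Fin n → ℂ) :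
    ∑ j, ‖Matrix.vecMul z (A.map (algebraMap ℝ ℂ)) j‖ ^ 2 ≤
      ‖Matrix.toEuclideanCLM (n := Fin n) (𝕜 := ℝ) A‖ ^ 2 * ∑ i, ‖z i‖ ^ 2 := by
  have hreal (v : Fin n → ℝ) : ∑ j, Matrix.vecMul v A j ^ 2 ≤
      ‖Matrix.toEuclideanCLM (n := Fin n) (𝕜 := ℝ) A‖ ^ 2 * ∑ i, v i ^ 2 := by
    have h := (Matrix.toEuclideanCLM (n := Fin n) (𝕜 := ℝ) (star A)).le_opNorm (WithLp.toLp 2 v)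
    have hstar : ‖star (Matrix.toEuclideanCLM (n := Fin n) (𝕜 := ℝ) A)‖ =
        ‖Matrix.toEuclideanCLM (n := Fin n) (𝕜 := ℝ) A‖ := by
      rw [ContinuousLinearMap.star_eq_adjoint, LinearIsometryEquiv.norm_map]
    rw [map_star, hstar] at h
    have h' := pow_le_pow_left₀ (norm_nonneg _) h 2
    rw [mul_pow, ← map_star, EuclideanSpace.real_norm_sq_eq, EuclideanSpace.real_norm_sq_eq] at h'
    simpa [Matrix.star_eq_conjTranspose, Matrix.conjTranspose_eq_transpose_of_trivial,
      Matrix.mulVec_transpose] using h'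
  have hre (j) : (Matrix.vecMul z (A.map (algebraMap ℝ ℂ)) j).re =
      Matrix.vecMul (fun i => (z i).re) A j := by
    simp [Matrix.vecMul, dotProduct]
  have him (j) : (Matrix.vecMul z (A.map (algebraMap ℝ ℂ)) j).im =
      Matrix.vecMul (fun i => (z i).im) A j := by
    simp [Matrix.vecMul, dotProduct]
  have hn (y : ℂ) : ‖y‖ ^ 2 = y.re ^ 2 + y.im ^ 2 := by
    rw [Complex.sq_norm, Complex.normSq_apply]; ring
  simp only [hn, hre, him, sum_add_distrib, mul_add]
  exact add_le_add (hreal _) (hreal _)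

/-! ### The orbit of a vector under the reflections -/

section Orbit

variable {n : ℕ} (A : Matrix (Fin n) (Fin n) ℝ) (x : Fin n → ℂ)

/-- The image of `x` under the first `k` reflections; it is constant for `k ≥ n`. -/
noncomputable def orbit (k : ℕ) : EuclideanSpace ℂ (Fin n) :=
  WithLp.toLp 2 (((((List.ofFn fun i => reflection A i).take k).reverse.prod).map
    (algebraMap ℝ ℂ)).mulVec x)

/-- The `i`-th row of `A` as a complex vector. -/
noncomputable def complexRow (i : Fin n) : EuclideanSpace ℂ (Fin n) :=
  WithLp.toLp 2 fun j => (A i j : ℂ)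

/-- The coefficient, along row `k`, of the projection of `orbit A x k` on that row; zero for
`k ≥ n`, and, by division by zero, when the row vanishes. -/
noncomputable def coeff (k : ℕ) : ℂ :=
  if h : k < n then
    inner ℂ (complexRow A ⟨k, h⟩) (orbit A x k) / ((A ⟨k, h⟩ ⬝ᵥ A ⟨k, h⟩ : ℝ) : ℂ)
  else 0

/-- The projection of `orbit A x k` on row `k`; zero for `k ≥ n`. -/
noncomputable def projection (k : ℕ) : EuclideanSpace ℂ (Fin n) :=
  if h : k < n then coeff A x k • complexRow A ⟨k, h⟩ else 0

lemma orbit_zero : orbit A x 0 = WithLp.toLp 2 x := by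
  simp [orbit]

lemma orbit_card : orbit A x n =
    WithLp.toLp 2 (((reflectionProd A).map (algebraMap ℝ ℂ)).mulVec x) := by
  rw [orbit, List.take_of_length_le (by simp), reflectionProd]

lemma reflection_mulVec (i : Fin n) (y : EuclideanSpace ℂ (Fin n)) :
    WithLp.toLp 2 (((reflection A i).map (algebraMap ℝ ℂ)).mulVec y.ofLp) =
      y - (2 : ℂ) • (inner ℂ (complexRow A i) y / ((A i ⬝ᵥ A i : ℝ) : ℂ)) • complexRow A i := by
  ext j
  simp only [reflection, complexRow, Matrix.mulVec, dotProduct, PiLp.inner_apply, Matrix.map_apply,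
    Matrix.sub_apply, Matrix.smul_apply, Matrix.vecMulVec_apply, PiLp.sub_apply, PiLp.smul_apply,
    smul_eq_mul, Complex.coe_algebraMap, RCLike.inner_apply, Complex.conj_ofReal]
  push_cast
  simp only [sub_mul, sum_sub_distrib]
  congr 1
  · simp [Matrix.one_apply, apply_ite]
  · rw [sum_div, sum_mul, mul_sum]
    refine sum_congr rfl fun k _ => ?_
    ring

lemma orbit_succ (k : ℕ) : orbit A x (k + 1) = orbit A x k - (2 : ℂ) • projection A x k := by
  by_cases h : k < n
  · have hstep : orbit A x (k + 1) = WithLp.toLp 2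
        (((reflection A ⟨k, h⟩).map (algebraMap ℝ ℂ)).mulVec (orbit A x k).ofLp) := by
      rw [orbit, orbit, List.take_add_one]
      simp [h, Matrix.mulVec_mulVec, -Complex.coe_algebraMap, Matrix.map_mul]
    rw [hstep, reflection_mulVec, projection, coeff]
    simp [h]
  · rw [projection, dif_neg h, orbit, orbit, List.take_of_length_le (by simp; omega),
      List.take_of_length_le (by simp; omega)]
    simp

lemma inner_complexRow_self (i : Fin n) :
    inner ℂ (complexRow A i) (complexRow A i) = ((A i ⬝ᵥ A i : ℝ) : ℂ) := by
  simp only [complexRow, PiLp.inner_apply, dotProduct, RCLike.inner_apply, Complex.conj_ofReal]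
  push_cast
  rfl

lemma inner_projection_orbit (k : ℕ) :
    inner ℂ (projection A x k) (orbit A x k) = ((‖projection A x k‖ ^ 2 : ℝ) : ℂ) := by
  by_cases h : k < n
  · have hself : ((‖projection A x k‖ ^ 2 : ℝ) : ℂ) =
        inner ℂ (projection A x k) (projection A x k) := by
      rw [inner_self_eq_norm_sq_to_K]; simp
    rw [hself, projection, dif_pos h, inner_smul_left, inner_smul_left, inner_smul_right,
      inner_complexRow_self, coeff, dif_pos h]
    by_cases h0 : A ⟨k, h⟩ ⬝ᵥ A ⟨k, h⟩ = 0
    · simp [h0]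
    · rw [div_mul_cancel₀ _ (by exact_mod_cast h0)]
  · simp [projection, h]

/-- `∑ u_k = Aᵀ z` for the part of the coefficient vector `z` supported on `s`. -/
lemma sum_projection_eq (s : Finset ℕ) :
    ∑ k ∈ s, projection A x k = WithLp.toLp 2 (Matrix.vecMul
      (fun i : Fin n => if (i : ℕ) ∈ s then coeff A x i else 0) (A.map (algebraMap ℝ ℂ))) := by
  have hfin : ∑ k ∈ s, projection A x k =
      ∑ i : Fin n, if (i : ℕ) ∈ s then projection A x i else 0 := by
    rw [Fin.sum_univ_eq_sum_range (fun i => if i ∈ s then projection A x i else 0) n,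
      ← sum_filter]
    symm
    refine sum_subset (fun i hi => (mem_filter.1 hi).2) fun i hi hni => ?_
    have : ¬ i < n := fun hin => hni (mem_filter.2 ⟨mem_range.2 hin, hi⟩)
    simp [projection, this]
  rw [hfin]
  ext j
  simp only [WithLp.ofLp_sum, Finset.sum_apply, Matrix.vecMul, dotProduct]
  refine sum_congr rfl fun i _ => ?_
  split_ifs <;> simp [projection, complexRow]

lemma sum_norm_sq_coeff_eq (s : Finset ℕ) :
    ∑ i : Fin n, ‖if (i : ℕ) ∈ s then coeff A x i else 0‖ ^ 2 = ∑ k ∈ s, ‖coeff A x k‖ ^ 2 := by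
  have hite (i : ℕ) : ‖if i ∈ s then coeff A x i else 0‖ ^ 2 =
      if i ∈ s then ‖coeff A x i‖ ^ 2 else 0 := by
    split_ifs <;> simp
  simp only [hite]
  rw [Fin.sum_univ_eq_sum_range (fun i => if i ∈ s then ‖coeff A x i‖ ^ 2 else 0) n, ← sum_filter]
  refine sum_subset (fun i hi => (mem_filter.1 hi).2) fun i hi hni => ?_
  have : ¬ i < n := fun hin => hni (mem_filter.2 ⟨mem_range.2 hin, hi⟩)
  simp [coeff, this]

lemma norm_sum_projection_sq_le (s : Finset ℕ) :
    ‖∑ k ∈ s, projection A x k‖ ^ 2 ≤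
      ‖Matrix.toEuclideanCLM (n := Fin n) (𝕜 := ℝ) A‖ ^ 2 * ∑ k ∈ s, ‖coeff A x k‖ ^ 2 := by
  rw [sum_projection_eq, EuclideanSpace.norm_sq_eq, ← sum_norm_sq_coeff_eq]
  exact sum_norm_sq_vecMul_le A _

lemma sum_norm_sq_coeff_le (hA : IsUnit A) :
    ∑ k ∈ Ico 0 n, ‖coeff A x k‖ ^ 2 ≤
      ‖Matrix.toEuclideanCLM (n := Fin n) (𝕜 := ℝ) A⁻¹‖ ^ 2 *
        ‖∑ k ∈ Ico 0 n, projection A x k‖ ^ 2 := by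
  rw [sum_projection_eq, EuclideanSpace.norm_sq_eq, ← sum_norm_sq_coeff_eq]
  have h := sum_norm_sq_vecMul_le A⁻¹ (Matrix.vecMul
      (fun i : Fin n => if (i : ℕ) ∈ Ico 0 n then coeff A x i else 0) (A.map (algebraMap ℝ ℂ)))
  rwa [Matrix.vecMul_vecMul, ← Matrix.map_mul,
    Matrix.mul_nonsing_inv A ((Matrix.isUnit_iff_isUnit_det A).1 hA),
    Matrix.map_one _ (map_zero _) (map_one _), Matrix.vecMul_one] at h

/-- If all coefficients vanish, `x` is never moved, hence is orthogonal to every row. -/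
lemma exists_coeff_ne_zero (hA : IsUnit A) (hx : x ≠ 0) : ∃ i : Fin n, coeff A x i ≠ 0 := by
  by_contra! hz
  apply hx
  have hp (k : ℕ) : projection A x k = 0 := by
    by_cases h : k < n
    · rw [projection, dif_pos h, hz ⟨k, h⟩, zero_smul]
    · simp [projection, h]
  have ho (k : ℕ) : orbit A x k = WithLp.toLp 2 x := by
    rw [reflected_eq_sub_sum (orbit_succ A x) k, orbit_zero]
    simp [hp]
  have hunit : IsUnit (A.map (algebraMap ℝ ℂ)) := by
    have := hA.map (algebraMap ℝ ℂ).mapMatrix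
    simpa using this
  refine Matrix.mulVec_injective_of_isUnit hunit ?_
  rw [Matrix.mulVec_zero]
  funext i
  have hi := hz i
  rw [coeff, dif_pos i.2, div_eq_zero_iff, ho] at hi
  rcases hi with hi | hi
  · simpa [complexRow, PiLp.inner_apply, Matrix.mulVec, dotProduct, mul_comm] using hi
  · have hrow : A i = 0 := dotProduct_self_eq_zero.1 (by exact_mod_cast hi)
    simp [Matrix.mulVec, dotProduct, hrow]

end Orbit

/-! ### Eigenvalues of the product of reflections -/

lemma exists_mulVec_eq_of_mem_roots {n : ℕ} {M : Matrix (Fin n) (Fin n) ℂ} {μ : ℂ}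
    (hμ : μ ∈ M.charpoly.roots) : ∃ x : Fin n → ℂ, x ≠ 0 ∧ M.mulVec x = μ • x := by
  have hroot := (Polynomial.mem_roots'.1 hμ).2
  rw [Polynomial.IsRoot, Matrix.eval_charpoly] at hroot
  obtain ⟨x, hx, h⟩ := Matrix.exists_mulVec_eq_zero_iff.2 hroot
  refine ⟨x, hx, ?_⟩
  rw [Matrix.sub_mulVec, sub_eq_zero] at h
  rw [← h]
  simp [Matrix.scalar_apply, ← Matrix.smul_one_eq_diagonal, Matrix.smul_mulVec]

lemma norm_eigenvalue_eq_one {n : ℕ} {A : Matrix (Fin n) (Fin n) ℝ} {μ : ℂ}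
    (hμ : μ ∈ ((reflectionProd A).map (algebraMap ℝ ℂ)).charpoly.roots) : ‖μ‖ = 1 := by
  obtain ⟨x, hx, h⟩ := exists_mulVec_eq_of_mem_roots hμ
  have hn := norm_reflected_eq (orbit_succ A x) (inner_projection_orbit A x) n
  rw [orbit_card, orbit_zero, h, WithLp.toLp_smul, norm_smul] at hn
  have hx' : ‖(WithLp.toLp 2 x : EuclideanSpace ℂ (Fin n))‖ ≠ 0 := by simpa using hx
  exact mul_right_cancel₀ hx' (by rw [hn, one_mul])

lemma two_le_norm_one_sub_eigenvalue_mul {n m : ℕ} (hn : n ≤ 2 ^ m)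
    {A : Matrix (Fin n) (Fin n) ℝ} (hA : IsUnit A) {μ : ℂ}
    (hμ : μ ∈ ((reflectionProd A).map (algebraMap ℝ ℂ)).charpoly.roots) :
    2 ≤ ‖1 - μ‖ * ((1 + m) * conditionNumber A ^ 2) := by
  obtain ⟨x, hx, h⟩ := exists_mulVec_eq_of_mem_roots hμ
  obtain ⟨i, hi⟩ := exists_coeff_ne_zero A x hA hx
  have hmain := two_mul_norm_sum_sq_le (orbit_succ A x) (inner_projection_orbit A x) hn
    (μ := μ) (by rw [orbit_card, orbit_zero, h, WithLp.toLp_smul]) (fun k => ‖coeff A x k‖ ^ 2)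
    _ (fun a b => norm_sum_projection_sq_le A x (Ico a b))
  have hinv := sum_norm_sq_coeff_le A x hA
  have hpos : 0 < ∑ k ∈ Ico 0 n, ‖coeff A x k‖ ^ 2 :=
    sum_pos' (fun _ _ => by positivity) ⟨i, by simp, by positivity⟩
  rw [conditionNumber]
  set a := ‖Matrix.toEuclideanCLM (n := Fin n) (𝕜 := ℝ) A‖
  set b := ‖Matrix.toEuclideanCLM (n := Fin n) (𝕜 := ℝ) A⁻¹‖
  set S := ∑ k ∈ Ico 0 n, ‖coeff A x k‖ ^ 2
  set W := ‖∑ k ∈ Ico 0 n, projection A x k‖ ^ 2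
  refine le_of_mul_le_mul_right ?_ hpos
  calc 2 * S ≤ 2 * (b ^ 2 * W) := by linarith
    _ = b ^ 2 * (2 * W) := by ring
    _ ≤ b ^ 2 * (‖1 - μ‖ * ((1 + m) * (a ^ 2 * S))) := by gcongr
    _ = ‖1 - μ‖ * ((1 + m) * (a * b) ^ 2) * S := by ring

lemma exists_isEigenphases_reflectionProd {n : ℕ} (A : Matrix (Fin n) (Fin n) ℝ) :
    ∃ θ : Fin n → ℝ, IsEigenphases (reflectionProd A) θ := by
  set r := ((reflectionProd A).map (algebraMap ℝ ℂ)).charpoly.roots with hr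
  have hcard : r.toList.length = n := by
    rw [Multiset.length_toList, hr, IsAlgClosed.card_roots_eq_natDegree,
      Matrix.charpoly_natDegree_eq_dim, Fintype.card_fin]
  refine ⟨fun l => (r.toList.get (l.cast hcard.symm)).arg, fun l => Complex.abs_arg_le_pi _, ?_⟩
  have hexp (l : Fin n) : Complex.exp (((r.toList.get (l.cast hcard.symm)).arg : ℂ) * Complex.I) =
      r.toList.get (l.cast hcard.symm) := by
    have hmem : r.toList.get (l.cast hcard.symm) ∈ r :=
      Multiset.mem_toList.1 (List.get_mem _ _)
    have h := Complex.norm_mul_exp_arg_mul_I (r.toList.get (l.cast hcard.symm))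
    rwa [norm_eigenvalue_eq_one hmem, Complex.ofReal_one, one_mul] at h
  simp only [hexp]
  rw [← hr, Fin.univ_def]
  simp only [Multiset.map_coe]
  conv_lhs => rw [← Multiset.coe_toList r]
  congr 1
  rw [← List.ofFn_eq_map]
  refine List.ext_get (by simp [hcard]) fun k h1 h2 => ?_
  simp

end Kaczmarz

open Kaczmarz in
theorem proposition3p4 :
    ∃ C : ℝ, ∀ (n : ℕ), 2 ≤ n → ∀ A : Matrix (Fin n) (Fin n) ℝ, IsUnit A →
      (∃ θ : Fin n → ℝ, Kaczmarz.IsEigenphases (Kaczmarz.reflectionProd A) θ) ∧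
      ∀ θ : Fin n → ℝ, Kaczmarz.IsEigenphases (Kaczmarz.reflectionProd A) θ →
        0 < (⨅ l, |θ l|) ∧
        1 / (⨅ l, |θ l|) ≤ C * (Real.log n * Kaczmarz.conditionNumber A ^ 2) := by
  refine ⟨3 / (2 * Real.log 2), fun n hn A hA =>
    ⟨exists_isEigenphases_reflectionProd A, fun θ hθ => ?_⟩⟩
  have : Nonempty (Fin n) := ⟨⟨0, by omega⟩⟩
  -- The infimum over a finite nonempty family is attained, so one phase has to be bounded.
  obtain ⟨l, hl⟩ := exists_eq_ciInf_of_finite (f := fun l => |θ l|)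
  rw [← hl]
  have hmem : Complex.exp ((θ l : ℂ) * Complex.I) ∈
      ((reflectionProd A).map (algebraMap ℝ ℂ)).charpoly.roots := by
    rw [hθ.2]
    exact Multiset.mem_map_of_mem _ (Finset.mem_univ l)
  have hgap := two_le_norm_one_sub_eigenvalue_mul (Nat.le_pow_clog one_lt_two n) hA hmem
  have hchord : ‖1 - Complex.exp ((θ l : ℂ) * Complex.I)‖ ≤ |θ l| := by
    rw [norm_sub_rev, mul_comm]
    exact Real.norm_exp_I_mul_ofReal_sub_one_le
  have hlog2 : 0 < Real.log 2 := Real.log_pos one_lt_two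
  have hlogn : Real.log 2 ≤ Real.log n := Real.log_le_log two_pos (by exact_mod_cast hn)
  have hclog : (Nat.clog 2 n : ℝ) * Real.log 2 ≤ Real.log n + Real.log 2 := by
    have hlt : 2 ^ (Nat.clog 2 n - 1) < n := Nat.pow_pred_clog_lt_self one_lt_two (by omega)
    have hpos : 0 < Nat.clog 2 n := Nat.clog_pos one_lt_two hn
    have h : Real.log ((2 : ℝ) ^ (Nat.clog 2 n - 1)) ≤ Real.log n :=
      Real.log_le_log (by positivity) (by exact_mod_cast hlt.le)
    rw [Real.log_pow, Nat.cast_sub hpos, Nat.cast_one] at h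
    linarith
  set K := conditionNumber A ^ 2
  have hK : 0 ≤ K := sq_nonneg _
  have hθK : 2 ≤ |θ l| * ((1 + Nat.clog 2 n) * K) :=
    hgap.trans (mul_le_mul_of_nonneg_right hchord (by positivity))
  have hθpos : 0 < |θ l| := by
    refine (abs_nonneg _).lt_of_ne fun h0 => ?_
    rw [← h0] at hθK
    linarith
  refine ⟨hθpos, ?_⟩
  -- `1 + ⌈log₂ n⌉ ≤ 2 + log₂ n ≤ 3 log₂ n` as `n ≥ 2`.
  have hbound : 1 + (Nat.clog 2 n : ℝ) ≤ 3 * Real.log n / Real.log 2 := by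
    rw [le_div_iff₀ hlog2]
    linarith
  rw [div_le_iff₀ hθpos]
  calc (1 : ℝ) ≤ |θ l| * ((1 + Nat.clog 2 n) * K) / 2 := by linarith
    _ ≤ |θ l| * ((3 * Real.log n / Real.log 2) * K) / 2 := by gcongr
    _ = 3 / (2 * Real.log 2) * (Real.log n * K) * |θ l| := by
      field_simp
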